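/- Let $G$ be a finite group. An equipment of $G$ is a subset $O\subset G$ that is closed under conjugation (a union of conjugacy classes) and generates $G$; the pair $(G,O)$ is then called an equipped finite group. Let $\widetilde G$ be the group generated by letters $y_g$, $g\in O$, subject to the relations $$y_{g_1}y_{g_2}=y_{g_2}y_{g_2^{-1}g_1g_2}=y_{g_1g_2g_1^{-1}}y_{g_1}\qquad (g_1,g_2\in O),$$ let $\beta:\widetilde G\to G$ be the homomorphism given by $\beta(y_g)=g$, and let the ambiguity index $a_{(G,O)}$ be the order of the group $\ker\beta\cap[\widetilde G,\widetilde G]$. Let $h_2(G)$ be the order of $H_2(G,\mathbb Z)$ and let $b_0(G)$ be the order of the Bogomolov multiplier $$B_0(G)=\ker\Bigl[H^2(G,\mathbb Q/\mathbb Z)\to\prod_{A\subset G}H^2(A,\mathbb Q/\mathbb Z)\Bigr],$$ where $A$ runs over all abelian subgroups of $G$, the maps are the restrictions, and $\mathbb Z$ and $\mathbb Q/\mathbb Z$ are trivial modules. Theorem. For every finite group $G$ the groups $B_0(G)$ and $H_2(G,\mathbb Z)$ are finite, and for every equipment $O$ of $G$ the group $\ker\beta\cap[\widetilde G,\widetilde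 G]$ is finite and $$b_0(G)\le a_{(G,O)}\le h_2(G).$$ Moreover, $G\setminus\{1\}$ is an equipment of $G$, and $a_{(G,G\setminus\{1\})}=b_0(G)$. -/

import Mathlib

universe u

/-- `O` is an equipment of the group `G`: a union of conjugacy classes of `G` (that is, a subset
closed under conjugation) which generates `G`. -/
structure IsEquipment {G : Type u} [Group G] (O : Set G) : Prop where
  conj_mem : ∀ x ∈ O, ∀ g : G, g * x * g⁻¹ ∈ O
  closure_eq_top : Subgroup.closure O = ⊤

/-- The relators of the `C`-group of `(G, O)`, on letters `y_g`, `g ∈ O`: they express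
`y_a y_b = y_b y_{b⁻¹ a b}` and `y_a y_b = y_{a b a⁻¹} y_a`. -/
def cRelators {G : Type u} [Group G] (O : Set G) : Set (FreeGroup O) :=
  {r | ∃ a b c : O, (c : G) = (b : G)⁻¹ * a * b ∧
      r = FreeGroup.of a * FreeGroup.of b * (FreeGroup.of b * FreeGroup.of c)⁻¹} ∪
  {r | ∃ a b c : O, (c : G) = (a : G) * b * (a : G)⁻¹ ∧
      r = FreeGroup.of a * FreeGroup.of b * (FreeGroup.of c * FreeGroup.of a)⁻¹}

/-- The `C`-group `G̃` associated with `(G, O)`. -/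
abbrev CGroup {G : Type u} [Group G] (O : Set G) : Type u :=
  PresentedGroup (cRelators O)

theorem lift_cRelators {G : Type u} [Group G] (O : Set G) :
    ∀ r ∈ cRelators O, FreeGroup.lift (fun g : O => (g : G)) r = 1 := by
  rintro r (⟨a, b, c, h, rfl⟩ | ⟨a, b, c, h, rfl⟩)
  · simp [h, mul_assoc]
  · simp [h]

/-- The natural homomorphism `β : G̃ → G`, `y_g ↦ g`. -/
def CGroup.toBase {G : Type u} [Group G] (O : Set G) : CGroup O →* G :=
  PresentedGroup.toGroup (lift_cRelators O)

/-- The subgroup `ker β ∩ [G̃, G̃]` of `G̃`. -/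
def ambiguityGroup {G : Type u} [Group G] (O : Set G) : Subgroup (CGroup O) :=
  (CGroup.toBase O).ker ⊓ commutator (CGroup O)

/-- The ambiguity index `a_{(G,O)}`: the order of `ker β ∩ [G̃, G̃]`. -/
noncomputable def ambiguityIndex {G : Type u} [Group G] (O : Set G) : ℕ :=
  Nat.card (ambiguityGroup O)

/-- The trivial `G`-module `ℤ` (lifted to the universe of `G`). -/
noncomputable abbrev trivialZ (G : Type u) [Group G] : Rep.{u} (ULift.{u} ℤ) G :=
  Rep.trivial (ULift.{u} ℤ) G (ULift.{u} ℤ)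

/-- The trivial `G`-module `ℚ/ℤ` (lifted to the universe of `G`);
`AddCircle (1 : ℚ)` is the quotient of `ℚ` by the subgroup generated by `1`. -/
noncomputable abbrev trivialQmodZ (G : Type u) [Group G] : Rep.{u} (ULift.{u} ℤ) G :=
  Rep.trivial (ULift.{u} ℤ) G (ULift.{u} (AddCircle (1 : ℚ)))

/-- The Schur multiplier `H₂(G, ℤ)`. -/
noncomputable abbrev schurMultiplier (G : Type u) [Group G] : ModuleCat.{u} (ULift.{u} ℤ) :=
  groupHomology (trivialZ G) 2

/-- `h₂(G)`, the order of `H₂(G, ℤ)`. -/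
noncomputable def schurOrder (G : Type u) [Group G] : ℕ :=
  Nat.card (schurMultiplier G)

/-- The restriction map `H²(G, ℚ/ℤ) → H²(A, ℚ/ℤ)` for a subgroup `A` of `G`
(the restriction of the trivial `G`-module `ℚ/ℤ` to `A` is the trivial `A`-module `ℚ/ℤ`). -/
noncomputable def resH2 {G : Type u} [Group G] (A : Subgroup G) :
    groupCohomology (trivialQmodZ G) 2 ⟶
      groupCohomology (Rep.res A.subtype (trivialQmodZ G)) 2 :=
  groupCohomology.map A.subtype
    (CategoryTheory.CategoryStruct.id (Rep.res A.subtype (trivialQmodZ G))) 2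

/-- The Bogomolov multiplier `B₀(G)`: the classes in `H²(G, ℚ/ℤ)` whose restriction to every
abelian subgroup of `G` is zero. -/
noncomputable def bogomolovMultiplier (G : Type u) [Group G] :
    Submodule (ULift.{u} ℤ) (groupCohomology (trivialQmodZ G) 2) :=
  ⨅ (A : Subgroup G) (_ : IsMulCommutative A), LinearMap.ker (resH2 A).hom

/-- `b₀(G)`, the order of `B₀(G)`. -/
noncomputable def bogomolovOrder (G : Type u) [Group G] : ℕ :=
  Nat.card (bogomolovMultiplier G)

/-!
The `C`-group `G̃` is a central extension of `G`: conjugation by `x` carries `y_g` to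
`y_{β(x) g β(x)⁻¹}`, so `K = ker β` is central. Put `A = K ∩ [G̃, G̃]`; it is finite by Schur's
theorem on groups whose centre has finite index.

*Duality.* Let `I ⊆ H²(G, ℚ/ℤ)` be the group of classes that become trivial on `G̃`. If `t` is a
cochain on `G̃` whose coboundary is the inflation of a cocycle `f` of `G`, then `a ↦ t a - t 1` is a
character of `A`. As `ℚ/ℤ` is divisible, every character of `A` arises in this way, and the
character is zero exactly when `f` is a coboundary (`transgressionChar_surjective`,
`transgressionChar_eq_zero_iff`). Hence `|I| = |Hom(A, ℚ/ℤ)| = |A|`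
(`card_transgressionClass_range`).

*Comparison with `B₀(G)`.* A class lies in `B₀(G)` exactly when lifts of commuting elements of `G`
commute in the corresponding central extension `E_f` (`H2π_mem_bogomolovMultiplier_iff`): the
restriction of `E_f` to an abelian subgroup is then abelian and splits, `ℚ/ℤ` being divisible. For
such a class, lifts to `E_f` of representatives of the conjugacy classes in `O` can be transported
by conjugation without ambiguity, which gives a homomorphism `G̃ → E_f` over `G`. So the class dies
on `G̃`, and `B₀(G) ⊆ I` (`bogomolovMultiplier_subset_range`). When `O = G ∖ {1}`, commuting elements
have commuting lifts in `G̃`, and therefore `I = B₀(G)` (`range_transgressionClass_compl_one`).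

*Comparison with `H₂(G, ℤ)`.* The cocycle of a section of `β` defines a homomorphism from 2-cycles
to `K` that kills boundaries. Its image contains `A`: a character of `K` trivial on the image extends
to `G̃` and thus vanishes on commutators (`card_ker_inf_commutator_le`). The group `H₂(G, ℤ)` is
finite because it is finitely generated and, by averaging, killed by `|G|`
(`finite_schurMultiplier`).
-/

/-! ### Characters with values in a divisible group -/

noncomputable instance ULift.instDivisibleByInt {D : Type*} [AddCommGroup D] [DivisibleBy D ℤ] :
    DivisibleBy (ULift.{u} D) ℤ where
  div x n := ⟨DivisibleBy.div x.down n⟩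
  div_zero x := ULift.ext _ _ (DivisibleBy.div_zero x.down)
  div_cancel x hn := ULift.ext _ _ (DivisibleBy.div_cancel x.down hn)

section Characters

variable {D : Type*} [AddCommGroup D] [DivisibleBy D ℤ]

/-- Characters with values in a divisible group extend along injections; `φ` need only be injective
modulo the kernel of the character. -/
theorem exists_addMonoidHom_comp_eq {X Y : Type*} [AddGroup X] [AddCommGroup Y]
    (φ : X →+ Y) (χ : X →+ D) (h : φ.ker ≤ χ.ker) : ∃ ψ : Y →+ D, ∀ x, ψ (φ x) = χ x := by
  let r := φ.rangeRestrict
  have hr : Function.Surjective r := φ.rangeRestrict_surjective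
  have hk : r.ker ≤ χ.ker := by
    intro x hx
    refine h ?_
    have : r x = 0 := hx
    exact congrArg Subtype.val this
  let c : φ.range →+ D := r.liftOfSurjective hr ⟨χ, hk⟩
  obtain ⟨ψ, hψ⟩ := (Module.Baer.of_divisible D).extension_property_addMonoidHom
    φ.range.subtype Subtype.val_injective c
  refine ⟨ψ, fun x => ?_⟩
  have h1 : ψ (φ x) = c (r x) := DFunLike.congr_fun hψ (r x)
  rw [h1]
  exact AddMonoidHom.liftOfRightInverse_comp_apply r _ _ ⟨χ, hk⟩ x

end Characters

/-- The roots of unity of order `n` in `ℚ/ℤ` are the multiples of `1 / n`. -/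
instance AddCircle.hasEnoughRootsOfUnity (n : ℕ) [NeZero n] :
    HasEnoughRootsOfUnity (Multiplicative (AddCircle (1 : ℚ))) n where
  prim := by
    refine ⟨Multiplicative.ofAdd (((1 / n : ℚ)) : AddCircle (1 : ℚ)), ?_⟩
    have : Fact ((0 : ℚ) < 1) := ⟨one_pos⟩
    have := AddCircle.addOrderOf_period_div (p := (1 : ℚ)) (NeZero.pos n)
    rw [IsPrimitiveRoot.iff_orderOf, orderOf_ofAdd_eq_addOrderOf, this]
  cyc := by
    have : Fact ((0 : ℚ) < 1) := ⟨one_pos⟩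
    refine ⟨⟨⟨toUnits (Multiplicative.ofAdd (((1 / n : ℚ)) : AddCircle (1 : ℚ))), ?_⟩, ?_⟩⟩
    · rw [mem_rootsOfUnity, ← map_pow, ← ofAdd_nsmul, ← AddCircle.coe_nsmul]
      have hn : (n : ℚ) ≠ 0 := Nat.cast_ne_zero.2 (NeZero.ne n)
      have : n • (1 / n : ℚ) = 1 := by simp [hn]
      rw [this, AddCircle.coe_period]
      simp
    · rintro ⟨x, hx⟩
      obtain ⟨y, rfl⟩ := toUnits.surjective x
      obtain ⟨q, hq⟩ := QuotientAddGroup.mk_surjective (Multiplicative.toAdd y)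
      have hy : y = Multiplicative.ofAdd (q : AddCircle (1 : ℚ)) := hq.symm
      subst hy
      rw [mem_rootsOfUnity, ← map_pow, ← ofAdd_nsmul, ← AddCircle.coe_nsmul] at hx
      have hx' : ((n • q : ℚ) : AddCircle (1 : ℚ)) = 0 :=
        ofAdd_eq_one.1 ((map_eq_one_iff _ toUnits.injective).1 hx)
      obtain ⟨m, hm⟩ := (AddCircle.coe_eq_zero_iff _).1 hx'
      have hn : (n : ℚ) ≠ 0 := Nat.cast_ne_zero.2 (NeZero.ne n)
      have hqm : q = m • (1 / n : ℚ) := by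
        simp at hm ⊢
        field_simp
        linarith
      refine Subgroup.mem_zpowers_iff.2 ⟨m, Subtype.ext ?_⟩
      rw [SubgroupClass.coe_zpow, ← map_zpow, ← ofAdd_zsmul, ← AddCircle.coe_zsmul, ← hqm]

/-- A finite abelian group has as many characters with values in `ℚ/ℤ` as elements. -/
theorem card_additive_addMonoidHom_addCircle (A : Type*) [Group A] [Finite A]
    (hA : ∀ a b : A, a * b = b * a) :
    Finite (Additive A →+ ULift.{u} (AddCircle (1 : ℚ))) ∧
      Nat.card (Additive A →+ ULift.{u} (AddCircle (1 : ℚ))) = Nat.card A := by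
  let : CommGroup A := { (inferInstance : Group A) with mul_comm := hA }
  have : NeZero (Monoid.exponent A) := ⟨Monoid.exponent_ne_zero_of_finite⟩
  obtain ⟨e⟩ := CommGroup.monoidHom_mulEquiv_of_hasEnoughRootsOfUnity A
    (Multiplicative (AddCircle (1 : ℚ)))
  let e₁ : (Additive A →+ ULift.{u} (AddCircle (1 : ℚ))) ≃ (Additive A →+ AddCircle (1 : ℚ)) :=
    { toFun φ := AddEquiv.ulift.toAddMonoidHom.comp φ
      invFun φ := AddEquiv.ulift.symm.toAddMonoidHom.comp φ
      left_inv φ := by ext; rfl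
      right_inv φ := by ext; rfl }
  let e₂ : (A →* Multiplicative (AddCircle (1 : ℚ))) ≃
      (A →* (Multiplicative (AddCircle (1 : ℚ)))ˣ) :=
    { toFun φ := toUnits.toMonoidHom.comp φ
      invFun φ := toUnits.symm.toMonoidHom.comp φ
      left_inv φ := by ext; rfl
      right_inv φ := by ext; rfl }
  let E := ((e₁.trans AddMonoidHom.toMultiplicativeRight).trans e₂).trans e.toEquiv
  exact ⟨Finite.of_equiv _ E.symm, Nat.card_congr E⟩

/-! ### Trivial-coefficient cocycles and their extensions -/

/-- The group law on `D × G` twisted by a 2-cocycle `f` with trivial action: the central extension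
of `G` by `D` with class `f`. The cocycle is kept in the type so that the group structure is an
instance. -/
@[ext]
structure CocycleExtension {G D : Type*} [Group G] [AddCommGroup D] (f : G × G → D)
    (hf : ∀ g h j, f (g * h, j) + f (g, h) = f (h, j) + f (g, h * j)) where
  /-- The component in the kernel `D`. -/
  fib : D
  /-- The component in the quotient `G`. -/
  base : G

namespace CocycleExtension

variable {G D : Type*} [Group G] [AddCommGroup D] {f : G × G → D}
  {hf : ∀ g h j, f (g * h, j) + f (g, h) = f (h, j) + f (g, h * j)}

theorem map_one_fst (hf : ∀ g h j, f (g * h, j) + f (g, h) = f (h, j) + f (g, h * j)) (g : G) :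
    f (1, g) = f (1, 1) := by
  simpa using (hf 1 1 g).symm

theorem map_one_snd (hf : ∀ g h j, f (g * h, j) + f (g, h) = f (h, j) + f (g, h * j)) (g : G) :
    f (g, 1) = f (1, 1) := by
  simpa using hf g 1 1

instance : Mul (CocycleExtension f hf) :=
  ⟨fun x y => ⟨x.fib + y.fib + f (x.base, y.base), x.base * y.base⟩⟩

-- The cocycle is not assumed normalised, hence the correction terms `f (1, 1)`.
instance : One (CocycleExtension f hf) := ⟨⟨-f (1, 1), 1⟩⟩

instance : Inv (CocycleExtension f hf) :=
  ⟨fun x => ⟨-x.fib - f (x.base⁻¹, x.base) - f (1, 1), x.base⁻¹⟩⟩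

@[simp] theorem fib_mul (x y : CocycleExtension f hf) :
    (x * y).fib = x.fib + y.fib + f (x.base, y.base) := rfl
@[simp] theorem base_mul (x y : CocycleExtension f hf) : (x * y).base = x.base * y.base := rfl
@[simp] theorem fib_one : (1 : CocycleExtension f hf).fib = -f (1, 1) := rfl
@[simp] theorem base_one : (1 : CocycleExtension f hf).base = 1 := rfl
@[simp] theorem fib_inv (x : CocycleExtension f hf) :
    x⁻¹.fib = -x.fib - f (x.base⁻¹, x.base) - f (1, 1) := rfl
@[simp] theorem base_inv (x : CocycleExtension f hf) : x⁻¹.base = x.base⁻¹ := rfl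

instance : Group (CocycleExtension f hf) :=
  Group.ofLeftAxioms
    (fun x y z => by
      ext
      · have := hf x.base y.base z.base
        simp only [fib_mul, base_mul]
        calc _ = x.fib + y.fib + z.fib + (f (x.base * y.base, z.base) + f (x.base, y.base)) := by
              abel
          _ = _ := by
              rw [this]
              abel
      · simp [mul_assoc])
    (fun x => by
      ext
      · simp [map_one_fst hf]
      · simp)
    (fun x => by
      ext
      · simp only [fib_mul, fib_inv, base_inv, fib_one]
        abel
      · simp)

/-- The projection of the extension onto its base. -/
def proj (f : G × G → D)
    (hf : ∀ g h j, f (g * h, j) + f (g, h) = f (h, j) + f (g, h * j)) :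
    CocycleExtension f hf →* G where
  toFun := base
  map_one' := rfl
  map_mul' _ _ := rfl

theorem mul_comm_of_base (x y : CocycleExtension f hf) (hc : x.base * y.base = y.base * x.base)
    (hs : f (x.base, y.base) = f (y.base, x.base)) : x * y = y * x := by
  ext
  · simp [hs, add_comm]
  · exact hc

end CocycleExtension

/-- An extension of an abelian group by a divisible group that is again abelian splits; in terms of
cocycles, a symmetric cocycle is a coboundary. -/
theorem exists_coboundary_of_symm {G D : Type*} [Group G] [AddCommGroup D] [DivisibleBy D ℤ]
    {f : G × G → D} (hf : ∀ g h j, f (g * h, j) + f (g, h) = f (h, j) + f (g, h * j))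
    (hG : ∀ g h : G, g * h = h * g) (hs : ∀ g h, f (g, h) = f (h, g)) :
    ∃ c : G → D, ∀ g h, c h - c (g * h) + c g = f (g, h) := by
  let : CommGroup (CocycleExtension f hf) :=
    { (inferInstance : Group (CocycleExtension f hf)) with
      mul_comm x y := CocycleExtension.mul_comm_of_base x y (hG _ _) (hs _ _) }
  let ι : D →+ Additive (CocycleExtension f hf) :=
    { toFun d := Additive.ofMul ⟨d - f (1, 1), 1⟩
      map_zero' := by
        apply Additive.toMul.injective
        ext <;> simp
      map_add' a b := by
        apply Additive.toMul.injective
        ext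
        · simp
          abel
        · simp }
  have hι : ι.ker ≤ (AddMonoidHom.id D).ker := by
    intro d hd
    have h := congrArg CocycleExtension.fib (congrArg Additive.toMul (show ι d = 0 from hd))
    simpa [ι] using h
  obtain ⟨r, hr⟩ := exists_addMonoidHom_comp_eq ι (AddMonoidHom.id D) hι
  refine ⟨fun g => r (Additive.ofMul ⟨0, g⟩), fun g h => ?_⟩
  have key : (Additive.ofMul (⟨0, g⟩ : CocycleExtension f hf)) + Additive.ofMul ⟨0, h⟩ =
      ι (f (g, h)) + Additive.ofMul ⟨0, g * h⟩ := by
    apply Additive.toMul.injective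
    ext
    · simp [ι, CocycleExtension.map_one_fst hf]
    · simp [ι]
  have h2 := congrArg r key
  rw [map_add, map_add, hr] at h2
  simp only [AddMonoidHom.id_apply] at h2
  rw [← sub_eq_iff_eq_add.2 h2]
  abel

/-! ### Transgression for a central extension -/

section Transgression

variable {G E : Type u} [Group G] [Group E]

/-- Pairs of a function `f` on `G × G` and a cochain `t` on `E` whose coboundary is the inflation
of `f`. -/
def transgressionPairs (D : Type*) [AddCommGroup D] (π : E →* G) :
    AddSubgroup ((G × G → D) × (E → D)) where
  carrier := {p | ∀ x y, p.1 (π x, π y) = p.2 y - p.2 (x * y) + p.2 x}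
  zero_mem' := by simp
  add_mem' {p q} hp hq x y := by
    have h1 := hp x y
    have h2 := hq x y
    simp only [Prod.fst_add, Prod.snd_add, Pi.add_apply, h1, h2]
    abel
  neg_mem' {p} hp x y := by
    have h1 := hp x y
    simp only [Prod.fst_neg, Prod.snd_neg, Pi.neg_apply, h1]
    abel

section

variable {D : Type*} [AddCommGroup D] {π : E →* G}

theorem transgressionPairs_cocycle (hπ : Function.Surjective π)
    {p : (G × G → D) × (E → D)} (hp : p ∈ transgressionPairs D π) (g h j : G) :
    p.1 (g * h, j) + p.1 (g, h) = p.1 (h, j) + p.1 (g, h * j) := by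
  obtain ⟨x, rfl⟩ := hπ g
  obtain ⟨y, rfl⟩ := hπ h
  obtain ⟨z, rfl⟩ := hπ j
  simp only [← map_mul]
  rw [hp, hp, hp, hp, mul_assoc]
  abel

theorem transgressionPairs_one {p : (G × G → D) × (E → D)} (hp : p ∈ transgressionPairs D π) :
    p.1 (1, 1) = p.2 1 := by
  have := hp 1 1
  simpa using this

theorem transgressionPairs_mul_ker (hπ : Function.Surjective π)
    {p : (G × G → D) × (E → D)} (hp : p ∈ transgressionPairs D π) (x : E) {k : E}
    (hk : k ∈ π.ker) : p.2 (x * k) = p.2 x + (p.2 k - p.2 1) := by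
  have h := hp x k
  rw [show π k = 1 from hk,
    CocycleExtension.map_one_snd (transgressionPairs_cocycle hπ hp), transgressionPairs_one hp] at h
  rw [h]
  abel

/-- The character of `ker π ∩ [E, E]` attached to a pair. -/
def transgressionChar (hπ : Function.Surjective π) :
    transgressionPairs D π →+ (Additive ↥(π.ker ⊓ commutator E) →+ D) where
  toFun p :=
    { toFun a := p.1.2 (a.toMul : E) - p.1.2 1
      map_zero' := by simp
      map_add' a b := by
        have := transgressionPairs_mul_ker hπ p.2 (a.toMul : E) b.toMul.2.1
        simp only [toMul_add, Subgroup.coe_mul, this]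
        abel }
  map_zero' := by ext; simp
  map_add' p q := by
    refine AddMonoidHom.ext fun a => ?_
    simp only [AddSubgroup.coe_add, Prod.snd_add, Pi.add_apply, AddMonoidHom.coe_mk,
      ZeroHom.coe_mk, AddMonoidHom.add_apply]
    abel

@[simp] theorem transgressionChar_apply (hπ : Function.Surjective π) (p : transgressionPairs D π)
    (a : Additive ↥(π.ker ⊓ commutator E)) :
    transgressionChar hπ p a = p.1.2 (a.toMul : E) - p.1.2 1 := rfl

/-- A character of `ker π` that vanishes on commutators of `E` factors through the image of `ker π`
in the abelianization, so it extends to `E`. -/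
theorem exists_extension_of_vanish [DivisibleBy D ℤ] (χ : Additive π.ker →+ D)
    (h : ∀ k : π.ker, (k : E) ∈ commutator E → χ (Additive.ofMul k) = 0) :
    ∃ ψ : Additive E →+ D, ∀ k : π.ker, ψ (Additive.ofMul (k : E)) = χ (Additive.ofMul k) := by
  let q : Additive E →+ Additive (Abelianization E) := (Abelianization.of (G := E)).toAdditive
  let φ : Additive π.ker →+ Additive (Abelianization E) := q.comp π.ker.subtype.toAdditive
  obtain ⟨ψ, hψ⟩ := exists_addMonoidHom_comp_eq φ χ (by
    intro k hk
    refine h k.toMul ?_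
    have : Abelianization.of (k.toMul : E) = 1 := hk
    rwa [← MonoidHom.mem_ker, Abelianization.ker_of] at this)
  exact ⟨ψ.comp q, fun k => hψ (Additive.ofMul k)⟩

theorem transgressionChar_surjective [DivisibleBy D ℤ] (hπ : Function.Surjective π)
    (hc : π.ker ≤ Subgroup.center E) :
    Function.Surjective (transgressionChar (D := D) hπ) := by
  intro χ
  let : CommGroup π.ker :=
    { (inferInstance : Group π.ker) with
      mul_comm a b := Subtype.ext (Subgroup.mem_center_iff.1 (hc b.2) a) }
  obtain ⟨ψ, hψ⟩ := exists_addMonoidHom_comp_eq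
    (Subgroup.inclusion (inf_le_left : π.ker ⊓ commutator E ≤ π.ker)).toAdditive χ (by
      intro a ha
      have : Subgroup.inclusion (inf_le_left : π.ker ⊓ commutator E ≤ π.ker) a.toMul = 1 := ha
      have : a.toMul = 1 := Subgroup.inclusion_injective inf_le_left (this.trans (map_one _).symm)
      have : a = 0 := this
      rw [this]
      exact map_zero χ)
  -- With `ψ` extending `χ` to `ker π`, the cochain `t (k * s g) = ψ k` induces `χ`.
  let s := Function.surjInv hπ
  have hs : ∀ g, π (s g) = g := Function.surjInv_eq hπ
  let κ : E → π.ker := fun x => ⟨x * (s (π x))⁻¹, by simp [MonoidHom.mem_ker, hs]⟩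
  let t : E → D := fun x => ψ (Additive.ofMul (κ x))
  have ht : ∀ (k : π.ker) (x : E), t (k * x) = ψ (Additive.ofMul k) + t x := by
    intro k x
    have : κ (k * x) = k * κ x := by
      apply Subtype.ext
      have hk : π k = 1 := k.2
      simp [κ, hk, mul_assoc]
    simp only [t, this, ofMul_mul, map_add]
  have hx : ∀ x : E, ∃ k : π.ker, x = k * s (π x) := fun x => ⟨κ x, by simp [κ]⟩
  let f : G × G → D := fun p => t (s p.2) - t (s p.1 * s p.2) + t (s p.1)
  have hmem : (f, t) ∈ transgressionPairs D π := by
    intro x y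
    obtain ⟨k, hk⟩ := hx x
    obtain ⟨l, hl⟩ := hx y
    have e1 : t x = ψ (Additive.ofMul k) + t (s (π x)) := by rw [← ht, ← hk]
    have e2 : t y = ψ (Additive.ofMul l) + t (s (π y)) := by rw [← ht, ← hl]
    have e3 : t (x * y) = ψ (Additive.ofMul k) + (ψ (Additive.ofMul l) +
        t (s (π x) * s (π y))) := by
      rw [← ht, ← ht]
      congr 1
      have hcl : s (π x) * (l : E) = l * s (π x) := Subgroup.mem_center_iff.1 (hc l.2) _
      calc x * y = (k * s (π x)) * (l * s (π y)) := by rw [← hk, ← hl]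
        _ = k * (s (π x) * l) * s (π y) := by group
        _ = _ := by rw [hcl]; group
    simp only [e1, e2, e3, f]
    abel
  refine ⟨⟨(f, t), hmem⟩, AddMonoidHom.ext fun a => ?_⟩
  have h1 := ht (Subgroup.inclusion inf_le_left a.toMul) 1
  rw [mul_one] at h1
  have h2 := hψ a
  rw [transgressionChar_apply, ← h2]
  exact sub_eq_iff_eq_add.2 h1

/-- The character attached to `(f, t)` vanishes exactly when `f` is a coboundary. -/
theorem transgressionChar_eq_zero_iff [DivisibleBy D ℤ] (hπ : Function.Surjective π)
    (p : transgressionPairs D π) :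
    transgressionChar hπ p = 0 ↔ ∃ c : G → D, ∀ g h, c h - c (g * h) + c g = p.1.1 (g, h) := by
  obtain ⟨⟨f, t⟩, hp⟩ := p
  have hft : ∀ x y, f (π x, π y) = t y - t (x * y) + t x := hp
  constructor
  · intro h
    let χ : Additive π.ker →+ D :=
      { toFun k := t (k.toMul : E) - t 1
        map_zero' := by simp
        map_add' a b := by
          have := transgressionPairs_mul_ker hπ hp (a.toMul : E) b.toMul.2
          simp only at this
          simp only [toMul_add, Subgroup.coe_mul, this]
          abel }
    obtain ⟨ψ, hψ⟩ := exists_extension_of_vanish χ fun k hk =>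
      DFunLike.congr_fun h (Additive.ofMul ⟨(k : E), k.2, hk⟩)
    let s := Function.surjInv hπ
    have hs : ∀ g, π (s g) = g := Function.surjInv_eq hπ
    -- Subtracting the homomorphism `ψ` leaves a cochain that is constant on the fibres of `π`.
    let u : E → D := fun x => t x - ψ (Additive.ofMul x)
    have hu : ∀ x, u x = u (s (π x)) := by
      intro x
      have hk : (s (π x))⁻¹ * x ∈ π.ker := by simp [MonoidHom.mem_ker, hs]
      have h1 := transgressionPairs_mul_ker hπ hp (s (π x)) hk
      have h2 := hψ ⟨_, hk⟩
      simp only [mul_inv_cancel_left] at h1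
      have h3 : χ (Additive.ofMul ⟨_, hk⟩) = t ((s (π x))⁻¹ * x) - t 1 := rfl
      rw [h3, ofMul_mul, ofMul_inv, map_add, map_neg] at h2
      simp only [u, h1, ← h2]
      abel
    refine ⟨fun g => u (s g), fun g h => ?_⟩
    have h1 : u (s (g * h)) = u (s g * s h) := by
      rw [hu (s g * s h), map_mul, hs, hs]
    have h2 := hft (s g) (s h)
    rw [hs, hs] at h2
    simp only [h1, h2, u, ofMul_mul, map_add]
    abel
  · rintro ⟨c, hcf⟩
    have hlin : ∀ x y, t (x * y) - c (π (x * y)) = (t x - c (π x)) + (t y - c (π y)) := by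
      intro x y
      have h1 := hft x y
      rw [← show _ = f (π x, π y) from hcf (π x) (π y)] at h1
      rw [map_mul]
      have h2 : c (π y) + c (π x) - c (π x * π y) = t y + t x - t (x * y) := by
        rw [sub_add_eq_add_sub, sub_add_eq_add_sub] at h1
        exact h1
      rw [sub_eq_sub_iff_add_eq_add] at h2
      rw [sub_add_sub_comm, sub_eq_sub_iff_add_eq_add]
      rw [add_comm (t (x * y)), add_comm (c (π x)), h2]
      abel
    let ψ : E →* Multiplicative D := MonoidHom.mk'
      (fun x => Multiplicative.ofAdd (t x - c (π x))) (fun x y => by rw [hlin]; rfl)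
    refine AddMonoidHom.ext fun a => ?_
    have h0 : ∀ x ∈ commutator E, t x = c (π x) := by
      intro x hx
      have := Abelianization.commutator_subset_ker ψ hx
      have h : t x - c (π x) = 0 := this
      exact sub_eq_zero.1 h
    have ha := h0 _ a.toMul.2.2
    have h1 := h0 1 (one_mem _)
    rw [transgressionChar_apply]
    change t (a.toMul : E) - t 1 = 0
    rw [ha, h1, show π (a.toMul : E) = 1 from a.toMul.2.1, map_one, sub_self]

end

end Transgression

/-! ### Second cohomology classes -/

section Cohomology

variable {G : Type u} [Group G]

theorem mem_cocycles₂_trivialQmodZ_iff (f : G × G → ULift.{u} (AddCircle (1 : ℚ))) :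
    f ∈ groupCohomology.cocycles₂ (trivialQmodZ G) ↔
      ∀ g h j, f (g * h, j) + f (g, h) = f (h, j) + f (g, h * j) :=
  groupCohomology.mem_cocycles₂_iff (A := trivialQmodZ G) f

theorem H2π_eq_zero_iff_exists (x : groupCohomology.cocycles₂ (trivialQmodZ G)) :
    groupCohomology.H2π (trivialQmodZ G) x = 0 ↔
      ∃ c : G → ULift.{u} (AddCircle (1 : ℚ)), ∀ g h, c h - c (g * h) + c g = x.1 (g, h) := by
  rw [groupCohomology.H2π_eq_zero_iff]
  constructor
  · rintro ⟨c, hc⟩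
    exact ⟨c, fun g h => congrFun hc (g, h)⟩
  · rintro ⟨c, hc⟩
    exact ⟨c, funext fun p => hc p.1 p.2⟩

theorem resH2_H2π_eq_zero_iff (A : Subgroup G)
    (x : groupCohomology.cocycles₂ (trivialQmodZ G)) :
    (resH2 A).hom (groupCohomology.H2π (trivialQmodZ G) x) = 0 ↔
      ∃ c : A → ULift.{u} (AddCircle (1 : ℚ)),
        ∀ g h, c h - c (g * h) + c g = x.1 ((g : G), (h : G)) := by
  have h1 : (resH2 A).hom (groupCohomology.H2π (trivialQmodZ G) x) =
      groupCohomology.H2π (Rep.res A.subtype (trivialQmodZ G))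
        (groupCohomology.mapCocycles₂ A.subtype
          (CategoryTheory.CategoryStruct.id (Rep.res A.subtype (trivialQmodZ G))) x) :=
    groupCohomology.H2π_comp_map_apply A.subtype _ x
  rw [h1, groupCohomology.H2π_eq_zero_iff]
  constructor
  · rintro ⟨c, hc⟩
    exact ⟨c, fun g h => congrFun hc (g, h)⟩
  · rintro ⟨c, hc⟩
    exact ⟨c, funext fun p => hc p.1 p.2⟩

/-- A class lies in the Bogomolov multiplier exactly when commuting elements of `G` still commute
in the corresponding central extension. -/
theorem H2π_mem_bogomolovMultiplier_iff (x : groupCohomology.cocycles₂ (trivialQmodZ G)) :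
    groupCohomology.H2π (trivialQmodZ G) x ∈ bogomolovMultiplier G ↔
      ∀ g h : G, g * h = h * g → x.1 (g, h) = x.1 (h, g) := by
  simp only [bogomolovMultiplier, Submodule.mem_iInf, LinearMap.mem_ker]
  constructor
  · intro H g h hgh
    let A := Subgroup.closure ({g, h} : Set G)
    have hA : IsMulCommutative A := Subgroup.isMulCommutative_closure (by
      rintro a (rfl | rfl) b (rfl | rfl) <;> first | rfl | exact hgh | exact hgh.symm)
    obtain ⟨c, hc⟩ := (resH2_H2π_eq_zero_iff A x).1 (H A hA)
    let g' : A := ⟨g, Subgroup.subset_closure (by simp)⟩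
    let h' : A := ⟨h, Subgroup.subset_closure (by simp)⟩
    have e1 := hc g' h'
    have e2 := hc h' g'
    have hc' : g' * h' = h' * g' := Subtype.ext hgh
    rw [show x.1 (g, h) = _ from e1.symm, show x.1 (h, g) = _ from e2.symm, hc']
    abel
  · intro H A hA
    have hcomm : ∀ a b : A, a * b = b * a := fun a b => hA.is_comm.comm a b
    rw [resH2_H2π_eq_zero_iff]
    have hx := (mem_cocycles₂_trivialQmodZ_iff x.1).1 x.2
    exact exists_coboundary_of_symm (f := fun p : A × A => x.1 ((p.1 : G), (p.2 : G)))
      (fun g h j => hx g h j) hcomm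
      (fun g h => H g h (congrArg Subtype.val (hcomm g h)))

variable {E : Type u} [Group E] {π : E →* G}

/-- The class in `H²(G, ℚ/ℤ)` of the cocycle of a pair. The classes obtained are those that become
trivial on `E`. -/
noncomputable def transgressionClass (hπ : Function.Surjective π) :
    transgressionPairs (ULift.{u} (AddCircle (1 : ℚ))) π →+
      groupCohomology (trivialQmodZ G) 2 where
  toFun p := groupCohomology.H2π (trivialQmodZ G)
    ⟨p.1.1, (mem_cocycles₂_trivialQmodZ_iff _).2 (transgressionPairs_cocycle hπ p.2)⟩
  map_zero' := map_zero (groupCohomology.H2π (trivialQmodZ G)).hom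
  map_add' p q := map_add (groupCohomology.H2π (trivialQmodZ G)).hom
    ⟨p.1.1, (mem_cocycles₂_trivialQmodZ_iff _).2 (transgressionPairs_cocycle hπ p.2)⟩
    ⟨q.1.1, (mem_cocycles₂_trivialQmodZ_iff _).2 (transgressionPairs_cocycle hπ q.2)⟩

theorem transgressionClass_ker (hπ : Function.Surjective π) :
    (transgressionClass hπ).ker =
      (transgressionChar (D := ULift.{u} (AddCircle (1 : ℚ))) hπ).ker := by
  ext p
  rw [AddMonoidHom.mem_ker, AddMonoidHom.mem_ker, transgressionChar_eq_zero_iff hπ p]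
  exact H2π_eq_zero_iff_exists _

/-- The classes that die on a central extension `E` are dual to `ker π ∩ [E, E]`: a class gives
the character by which its trivialising cochain restricts to `ker π ∩ [E, E]`. -/
theorem card_transgressionClass_range (hπ : Function.Surjective π)
    (hc : π.ker ≤ Subgroup.center E) [Finite ↥(π.ker ⊓ commutator E)] :
    Finite (transgressionClass hπ).range ∧
      Nat.card (transgressionClass hπ).range = Nat.card ↥(π.ker ⊓ commutator E) := by
  obtain ⟨h1, h2⟩ := card_additive_addMonoidHom_addCircle.{u} ↥(π.ker ⊓ commutator E)
    fun a b => Subtype.ext (Subgroup.mem_center_iff.1 (hc b.2.1) a)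
  let e := (QuotientAddGroup.quotientKerEquivRange (transgressionClass hπ)).symm.trans
    ((QuotientAddGroup.quotientAddEquivOfEq (transgressionClass_ker hπ)).trans
      (QuotientAddGroup.quotientKerEquivOfSurjective _ (transgressionChar_surjective hπ hc)))
  exact ⟨Finite.of_equiv _ e.toEquiv.symm, (Nat.card_congr e.toEquiv).trans h2⟩

end Cohomology

/-! ### The `C`-group as a central extension -/

namespace CGroup

variable {G : Type u} [Group G] {O : Set G}

/-- The generator `y_g`. -/
def of (g : O) : CGroup O := PresentedGroup.of g

@[simp] theorem toBase_of (g : O) : toBase O (of g) = g :=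
  PresentedGroup.toGroup.of _

theorem closure_range_of : Subgroup.closure (Set.range (of : O → CGroup O)) = ⊤ :=
  PresentedGroup.closure_range_of _

theorem of_mul_of_conj (a b c : O) (h : (c : G) = a * b * (a : G)⁻¹) :
    of a * of b = of c * of a := by
  have : (QuotientGroup.mk (FreeGroup.of a * FreeGroup.of b *
      (FreeGroup.of c * FreeGroup.of a)⁻¹) : CGroup O) = 1 :=
    PresentedGroup.one_of_mem (Or.inr ⟨a, b, c, h, rfl⟩)
  exact mul_inv_eq_one.1 this

/-- Conjugation by `x` carries `y_b` to `y_c` with `c = β(x) b β(x)⁻¹`. -/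
theorem mul_of_conj (hO : IsEquipment O) (x : CGroup O) :
    ∀ b c : O, (c : G) = toBase O x * b * (toBase O x)⁻¹ → x * of b = of c * x := by
  have hx : x ∈ Subgroup.closure (Set.range (of : O → CGroup O)) := by
    rw [closure_range_of]
    trivial
  induction hx using Subgroup.closure_induction with
  | mem x hx =>
    obtain ⟨a, rfl⟩ := hx
    intro b c h
    exact of_mul_of_conj a b c (by simpa using h)
  | one =>
    intro b c h
    have : c = b := Subtype.ext (by simpa using h)
    simp [this]
  | mul x y _ _ hx hy =>
    intro b c h
    let d : O := ⟨_, hO.conj_mem b b.2 (toBase O y)⟩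
    rw [mul_assoc, hy b d rfl, ← mul_assoc, hx d c (by simp [h, d, mul_assoc]), mul_assoc]
  | inv x _ hx =>
    intro b c h
    have := hx c b (by simp [h, mul_assoc])
    rw [inv_mul_eq_iff_eq_mul, ← mul_assoc, this, mul_inv_cancel_right]

theorem ker_toBase_le_center (hO : IsEquipment O) :
    (toBase O).ker ≤ Subgroup.center (CGroup O) := by
  intro k hk
  have hk1 : toBase O k = 1 := hk
  rw [Subgroup.mem_center_iff]
  intro x
  have hx : x ∈ Subgroup.closure (Set.range (of : O → CGroup O)) := by
    rw [closure_range_of]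
    trivial
  induction hx using Subgroup.closure_induction with
  | mem x hx =>
    obtain ⟨b, rfl⟩ := hx
    exact (mul_of_conj hO k b b (by simp [hk1])).symm
  | one => simp
  | mul x y _ _ hx hy => rw [mul_assoc, hy, ← mul_assoc, hx, mul_assoc]
  | inv x _ hx => exact (Commute.inv_left hx : Commute x⁻¹ k)

theorem toBase_surjective (hO : IsEquipment O) : Function.Surjective (toBase O) := by
  rw [← MonoidHom.range_eq_top, eq_top_iff, ← hO.closure_eq_top, Subgroup.closure_le]
  intro g hg
  exact ⟨of ⟨g, hg⟩, toBase_of _⟩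

end CGroup

/-- Commutators only depend on the cosets of the centre. -/
theorem finite_commutatorSet_of_finiteIndex_center (E : Type*) [Group E]
    [(Subgroup.center E).FiniteIndex] : Finite (commutatorSet E) := by
  refine Set.Finite.subset (Set.finite_range
    fun p : (E ⧸ Subgroup.center E) × (E ⧸ Subgroup.center E) =>
      p.1.out * p.2.out * p.1.out⁻¹ * p.2.out⁻¹) ?_
  rintro _ ⟨x, y, rfl⟩
  refine ⟨(x, y), ?_⟩
  obtain ⟨z, hz⟩ := QuotientGroup.mk_out_eq_mul (Subgroup.center E) x
  obtain ⟨w, hw⟩ := QuotientGroup.mk_out_eq_mul (Subgroup.center E) y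
  have hz' := Subgroup.mem_center_iff.1 z.2
  have hw' := Subgroup.mem_center_iff.1 w.2
  simp only [hz, hw, commutatorElement_def, mul_inv_rev]
  calc x * z * (y * w) * ((z : E)⁻¹ * x⁻¹) * ((w : E)⁻¹ * y⁻¹)
      = x * (z * (y * w)) * (z : E)⁻¹ * x⁻¹ * ((w : E)⁻¹ * y⁻¹) := by group
    _ = x * y * (w * x⁻¹) * ((w : E)⁻¹ * y⁻¹) := by rw [← hz' (y * w)]; group
    _ = x * y * x⁻¹ * y⁻¹ := by rw [← hw' x⁻¹]; group

/-- The kernel of `β` is central of finite index, so Schur's theorem makes `[G̃, G̃]` finite. -/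
theorem finite_ambiguityGroup {G : Type u} [Group G] [Finite G] {O : Set G}
    (hO : IsEquipment O) : Finite (ambiguityGroup O) := by
  have : (CGroup.toBase O).ker.FiniteIndex := inferInstance
  have : (Subgroup.center (CGroup O)).FiniteIndex :=
    Subgroup.finiteIndex_of_le (CGroup.ker_toBase_le_center hO)
  have := finite_commutatorSet_of_finiteIndex_center (CGroup O)
  exact Finite.of_injective _ (Subgroup.inclusion_injective
    (inf_le_right : ambiguityGroup O ≤ commutator (CGroup O)))

section Bogomolov

variable {G : Type u} [Group G] {O : Set G}

/-- If lifts of commuting elements commute in `E`, the class representatives of `O` can be lifted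
to `E` and the lifts transported by conjugation, giving a conjugation-equivariant section of
`π` over `O`. -/
theorem exists_equivariant_lift {E : Type*} [Group E] (π : E →* G) (hπ : Function.Surjective π)
    (hcomm : ∀ x y : E, π x * π y = π y * π x → x * y = y * x) :
    ∃ s : G → E, (∀ g, π (s g) = g) ∧ ∀ (e : E) (g : G), e * s g * e⁻¹ = s (π e * g * (π e)⁻¹) := by
  let σ := Function.surjInv hπ
  have hσ : ∀ g, π (σ g) = g := Function.surjInv_eq hπ
  let r : G → G := fun g => (ConjClasses.mk g).out
  have hr : ∀ g, ∃ h : G, h * r g * h⁻¹ = g := fun g =>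
    isConj_iff.1 (ConjClasses.mk_eq_mk_iff_isConj.1 (Quotient.out_eq (ConjClasses.mk g)))
  choose w hw using hr
  let s : G → E := fun g => σ (w g) * σ (r g) * (σ (w g))⁻¹
  have hs : ∀ g, π (s g) = g := fun g => by simp [s, hσ, hw]
  refine ⟨s, hs, fun e g => ?_⟩
  have hrr : r (π e * g * (π e)⁻¹) = r g := by
    have : ConjClasses.mk (π e * g * (π e)⁻¹) = ConjClasses.mk g :=
      ConjClasses.mk_eq_mk_iff_isConj.2 (isConj_iff.2 ⟨(π e)⁻¹, by group⟩)
    simp only [r, this]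
  generalize hg' : π e * g * (π e)⁻¹ = g' at hrr ⊢
  -- `u` carries the chosen lift of the representative to itself, since it does so in `G`.
  let u : E := (σ (w g'))⁻¹ * (e * σ (w g))
  have hwg : w g * r g = g * w g := by rw [← mul_inv_eq_iff_eq_mul, hw]
  have hwg' : r g * (w g')⁻¹ = (w g')⁻¹ * g' := by
    have := hw g'
    rw [hrr] at this
    rw [eq_inv_mul_iff_mul_eq, ← mul_assoc, this]
  have hu : u * σ (r g) = σ (r g) * u := by
    apply hcomm
    have : π u = (w g')⁻¹ * (π e * w g) := by simp [u, hσ]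
    rw [this, hσ]
    calc (w g')⁻¹ * (π e * w g) * r g = (w g')⁻¹ * π e * (w g * r g) := by group
      _ = (w g')⁻¹ * (π e * g * (π e)⁻¹) * (π e * w g) := by rw [hwg]; group
      _ = r g * (w g')⁻¹ * (π e * w g) := by rw [hg', hwg']
      _ = _ := by group
  have hew : e * σ (w g) = σ (w g') * u := by simp [u]
  calc e * s g * e⁻¹ = (e * σ (w g)) * σ (r g) * (e * σ (w g))⁻¹ := by simp only [s]; group
    _ = σ (w g') * (u * σ (r g)) * u⁻¹ * (σ (w g'))⁻¹ := by rw [hew]; group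
    _ = s g' := by rw [hu]; simp only [s, hrr]; group

/-- A class of `B₀(G)` dies on `G̃`: the `C`-group maps to the central extension of the class. -/
theorem bogomolovMultiplier_subset_range (hO : IsEquipment O)
    {α : groupCohomology (trivialQmodZ G) 2} (hα : α ∈ bogomolovMultiplier G) :
    α ∈ (transgressionClass (CGroup.toBase_surjective hO)).range := by
  induction α using groupCohomology.H2_induction_on with | _ x
  rw [H2π_mem_bogomolovMultiplier_iff] at hα
  have hf := (mem_cocycles₂_trivialQmodZ_iff x.1).1 x.2
  let π := CocycleExtension.proj x.1 hf
  obtain ⟨s, hs, hconj⟩ := exists_equivariant_lift π (fun g => ⟨⟨0, g⟩, rfl⟩)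
    (fun y z h => CocycleExtension.mul_comm_of_base y z h (hα _ _ h))
  have hrel : ∀ r ∈ cRelators O, FreeGroup.lift (fun g : O => s g) r = 1 := by
    rintro r (⟨a, b, c, h, rfl⟩ | ⟨a, b, c, h, rfl⟩)
    · have h1 := hconj (s b) c
      rw [hs, h, show (b : G) * ((b : G)⁻¹ * a * b) * (b : G)⁻¹ = a by group, ← h] at h1
      simp only [map_mul, map_inv, FreeGroup.lift_apply_of]
      rw [mul_inv_eq_one, ← h1, inv_mul_cancel_right]
    · have h1 := hconj (s a) b
      rw [hs, ← h] at h1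
      simp only [map_mul, map_inv, FreeGroup.lift_apply_of]
      rw [mul_inv_eq_one, ← h1, inv_mul_cancel_right]
  let Φ : CGroup O →* CocycleExtension x.1 hf := PresentedGroup.toGroup hrel
  have hΦ : π.comp Φ = CGroup.toBase O := by
    refine PresentedGroup.ext fun g => ?_
    have h1 : Φ (PresentedGroup.of g) = s g := PresentedGroup.toGroup.of hrel
    have h2 : CGroup.toBase O (PresentedGroup.of g) = g := CGroup.toBase_of g
    rw [MonoidHom.comp_apply, h1, h2, hs]
  have hbase : ∀ y, (Φ y).base = CGroup.toBase O y := fun y => DFunLike.congr_fun hΦ y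
  refine ⟨⟨(x.1, fun y => -(Φ y).fib), fun y z => ?_⟩, rfl⟩
  simp only [map_mul, CocycleExtension.fib_mul, hbase]
  abel

theorem isEquipment_compl_one : IsEquipment ({1}ᶜ : Set G) where
  conj_mem x hx g := by simpa using hx
  closure_eq_top := by
    rw [eq_top_iff]
    intro g _
    by_cases h : g = 1
    · rw [h]
      exact one_mem _
    · exact Subgroup.subset_closure h

/-- For `O = G ∖ {1}`, commuting elements have commuting lifts in `G̃`, so that a class dying on
`G̃` lies in `B₀(G)`. -/
theorem range_transgressionClass_compl_one :
    (transgressionClass (CGroup.toBase_surjective (isEquipment_compl_one (G := G)))).range =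
      (bogomolovMultiplier G).toAddSubgroup := by
  ext α
  refine ⟨?_, bogomolovMultiplier_subset_range isEquipment_compl_one⟩
  rintro ⟨⟨⟨f, t⟩, hp⟩, rfl⟩
  refine (H2π_mem_bogomolovMultiplier_iff _).2 fun g h hgh => ?_
  change f (g, h) = f (h, g)
  have hcoc := transgressionPairs_cocycle (CGroup.toBase_surjective isEquipment_compl_one) hp
  by_cases hg : g = 1
  · subst hg
    exact (CocycleExtension.map_one_fst hcoc h).trans (CocycleExtension.map_one_snd hcoc h).symm
  by_cases hh : h = 1
  · subst hh
    exact (CocycleExtension.map_one_snd hcoc g).trans (CocycleExtension.map_one_fst hcoc g).symm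
  let a : ({1}ᶜ : Set G) := ⟨g, hg⟩
  let b : ({1}ᶜ : Set G) := ⟨h, hh⟩
  have hab : CGroup.of a * CGroup.of b = CGroup.of b * CGroup.of a :=
    CGroup.of_mul_of_conj a b b (by simp [a, b, hgh])
  have h1 := hp (CGroup.of a) (CGroup.of b)
  have h2 := hp (CGroup.of b) (CGroup.of a)
  simp only [CGroup.toBase_of] at h1 h2
  change f (g, h) = _ at h1
  change f (h, g) = _ at h2
  rw [h1, h2, hab]
  abel

end Bogomolov

/-! ### The Schur multiplier -/

section Schur

variable {G : Type u} [Group G]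

instance ULift.instModuleFiniteInt : Module.Finite ℤ (ULift.{u} ℤ) :=
  Module.Finite.equiv (AddEquiv.ulift (α := ℤ)).symm.toIntLinearEquiv

/-- Averaging over the first variable gives a contracting homotopy up to the factor `|G|`. -/
theorem card_nsmul_mem_boundaries₂ [Finite G] {z : G × G →₀ ULift.{u} ℤ}
    (hz : z ∈ groupHomology.cycles₂ (trivialZ G)) :
    Nat.card G • z ∈ groupHomology.boundaries₂ (trivialZ G) := by
  cases nonempty_fintype G
  let S : (G × G →₀ ULift.{u} ℤ) →+ (G × G × G →₀ ULift.{u} ℤ) :=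
    Finsupp.liftAddHom fun p => ∑ g : G, Finsupp.singleAddHom (g, p.1, p.2)
  let L : (G →₀ ULift.{u} ℤ) →+ (G × G →₀ ULift.{u} ℤ) :=
    Finsupp.liftAddHom fun h => ∑ g : G, Finsupp.singleAddHom (g, h)
  let d₃ : (G × G × G →₀ ULift.{u} ℤ) →+ (G × G →₀ ULift.{u} ℤ) :=
    (groupHomology.d₃₂ (trivialZ G)).hom.toAddMonoidHom
  let d₂ : (G × G →₀ ULift.{u} ℤ) →+ (G →₀ ULift.{u} ℤ) :=
    (groupHomology.d₂₁ (trivialZ G)).hom.toAddMonoidHom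
  have hd₃ : ∀ (g h j : G) (a : ULift.{u} ℤ), d₃ (Finsupp.single (g, h, j) a) =
      Finsupp.single (h, j) a - Finsupp.single (g * h, j) a + Finsupp.single (g, h * j) a -
        Finsupp.single (g, h) a := fun g h j a => groupHomology.d₃₂_single (A := trivialZ G) _ _
  have hd₂ : ∀ (h j : G) (a : ULift.{u} ℤ), d₂ (Finsupp.single (h, j) a) =
      Finsupp.single j a - Finsupp.single (h * j) a + Finsupp.single h a :=
    fun h j a => groupHomology.d₂₁_single (A := trivialZ G) _ _
  have key : d₃.comp S + L.comp d₂ = nsmulAddMonoidHom (Nat.card G) := by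
    refine Finsupp.addHom_ext fun p a => ?_
    obtain ⟨h, j⟩ := p
    have hS : S (Finsupp.single (h, j) a) = ∑ g : G, Finsupp.single (g, h, j) a := by
      simp [S]
    have hL : ∀ h, L (Finsupp.single h a) = ∑ g : G, Finsupp.single (g, h) a := by
      intro h
      simp [L]
    have hperm : ∑ g : G, Finsupp.single (g * h, j) a = ∑ g : G, Finsupp.single (g, j) a :=
      Fintype.sum_equiv (Equiv.mulRight h) _ _ fun g => rfl
    simp only [AddMonoidHom.add_apply, AddMonoidHom.comp_apply, hS, hd₂, map_sum, hd₃, map_add,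
      map_sub, hL, Finset.sum_add_distrib, Finset.sum_sub_distrib, hperm, Finset.sum_const,
      Finset.card_univ, nsmulAddMonoidHom_apply, Nat.card_eq_fintype_card]
    abel
  have h1 := DFunLike.congr_fun key z
  have h2 : d₂ z = 0 := hz
  simp only [AddMonoidHom.add_apply, AddMonoidHom.comp_apply, h2, map_zero, add_zero,
    nsmulAddMonoidHom_apply] at h1
  exact ⟨S z, h1⟩

theorem H2π_trivialZ_surjective :
    Function.Surjective (groupHomology.H2π (trivialZ G)) :=
  (ModuleCat.epi_iff_surjective _).1 inferInstance

theorem finite_schurMultiplier (G : Type u) [Group G] [Finite G] :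
    Finite (schurMultiplier G) := by
  have : IsNoetherian ℤ (G × G →₀ ULift.{u} ℤ) := inferInstance
  let Z := (groupHomology.cycles₂ (trivialZ G)).toAddSubgroup
  let q : Z →+ schurMultiplier G := (groupHomology.H2π (trivialZ G)).hom.toAddMonoidHom
  have hq : Function.Surjective q := H2π_trivialZ_surjective
  have hZ : Module.Finite ℤ (AddSubgroup.toIntSubmodule Z) := inferInstance
  have : AddGroup.FG Z := Module.Finite.iff_addGroup_fg.1 hZ
  have : AddGroup.FG (schurMultiplier G) := AddGroup.fg_of_surjective hq
  refine AddCommGroup.finite_of_fg_isAddTorsion _ fun y => ?_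
  obtain ⟨z, rfl⟩ := hq y
  refine isOfFinAddOrder_iff_nsmul_eq_zero.2 ⟨Nat.card G, Nat.card_pos, ?_⟩
  rw [← map_nsmul]
  exact (groupHomology.H2π_eq_zero_iff (A := trivialZ G) _).2 (card_nsmul_mem_boundaries₂ z.2)

/-- For a central extension with quotient `G`, evaluating the cocycle of a section on cycles maps
`H₂(G, ℤ)` onto a subgroup of the kernel that contains `ker π ∩ [E, E]`. -/
theorem card_ker_inf_commutator_le [Finite G] {E : Type u} [Group E] {π : E →* G}
    (hπ : Function.Surjective π) (hc : π.ker ≤ Subgroup.center E) :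
    Nat.card ↥(π.ker ⊓ commutator E) ≤ schurOrder G := by
  let : CommGroup π.ker :=
    { (inferInstance : Group π.ker) with
      mul_comm a b := Subtype.ext (Subgroup.mem_center_iff.1 (hc b.2) a) }
  obtain ⟨s, hs, hs1⟩ : ∃ s : G → E, (∀ g, π (s g) = g) ∧ s 1 = 1 := by
    classical
    refine ⟨Function.update (Function.surjInv hπ) 1 1, fun g => ?_, by simp⟩
    by_cases hg : g = 1
    · simp [hg]
    · simp [hg, Function.surjInv_eq hπ]
  let F : G × G → π.ker := fun p =>
    ⟨s p.1 * s p.2 * (s (p.1 * p.2))⁻¹, by simp [MonoidHom.mem_ker, hs]⟩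
  have hF : ∀ g h, s g * s h = F (g, h) * s (g * h) := fun g h => by simp [F]
  have hcoc : ∀ g h j, F (g, h) * F (g * h, j) = F (h, j) * F (g, h * j) := by
    intro g h j
    apply Subtype.ext
    rw [Subgroup.coe_mul, Subgroup.coe_mul]
    have hcen := Subgroup.mem_center_iff.1 (hc (F (h, j)).2) (s g)
    apply mul_right_cancel (b := s (g * h * j))
    calc (F (g, h) : E) * F (g * h, j) * s (g * h * j)
        = F (g, h) * (F (g * h, j) * s (g * h * j)) := by group
      _ = s g * (s h * s j) := by rw [← hF, ← mul_assoc, ← hF, mul_assoc]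
      _ = F (h, j) * (s g * s (h * j)) := by rw [hF, ← mul_assoc, hcen, mul_assoc]
      _ = _ := by rw [hF g (h * j), mul_assoc g h j]; group
  let L : (G × G →₀ ULift.{u} ℤ) →+ Additive π.ker :=
    Finsupp.liftAddHom fun p =>
      ((zmultiplesHom (Additive π.ker)) (Additive.ofMul (F p))).comp AddEquiv.ulift.toAddMonoidHom
  have hL : ∀ p (a : ULift.{u} ℤ), L (Finsupp.single p a) = a.down • Additive.ofMul (F p) := by
    intro p a
    simp only [L, Finsupp.liftAddHom_apply_single, AddMonoidHom.comp_apply, zmultiplesHom_apply]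
    rfl
  let d₃ : (G × G × G →₀ ULift.{u} ℤ) →+ (G × G →₀ ULift.{u} ℤ) :=
    (groupHomology.d₃₂ (trivialZ G)).hom.toAddMonoidHom
  let d₂ : (G × G →₀ ULift.{u} ℤ) →+ (G →₀ ULift.{u} ℤ) :=
    (groupHomology.d₂₁ (trivialZ G)).hom.toAddMonoidHom
  have hd₃ : ∀ (g h j : G) (a : ULift.{u} ℤ), d₃ (Finsupp.single (g, h, j) a) =
      Finsupp.single (h, j) a - Finsupp.single (g * h, j) a + Finsupp.single (g, h * j) a -
        Finsupp.single (g, h) a := fun g h j a => groupHomology.d₃₂_single (A := trivialZ G) _ _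
  have hd₂ : ∀ (h j : G) (a : ULift.{u} ℤ), d₂ (Finsupp.single (h, j) a) =
      Finsupp.single j a - Finsupp.single (h * j) a + Finsupp.single h a :=
    fun h j a => groupHomology.d₂₁_single (A := trivialZ G) _ _
  have hLd : L.comp d₃ = 0 := by
    refine Finsupp.addHom_ext fun p a => ?_
    obtain ⟨g, h, j⟩ := p
    have h1 : Additive.ofMul (F (g, h)) + Additive.ofMul (F (g * h, j)) =
      Additive.ofMul (F (h, j)) + Additive.ofMul (F (g, h * j)) :=
        congrArg Additive.ofMul (hcoc g h j)
    simp only [AddMonoidHom.comp_apply, hd₃, map_add, map_sub, hL, ← smul_sub, ← smul_add,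
      AddMonoidHom.zero_apply]
    rw [sub_add_eq_add_sub, ← h1]
    simp
  -- Otherwise some character of `ker π` kills the values of the cocycle on cycles but not `a`.
  have hmem : ∀ a : ↥(π.ker ⊓ commutator E), ∃ z : groupHomology.cycles₂ (trivialZ G),
      L z.1 = Additive.ofMul (⟨a, a.2.1⟩ : π.ker) := by
    intro a
    let B : AddSubgroup (Additive π.ker) :=
      (groupHomology.cycles₂ (trivialZ G)).toAddSubgroup.map L
    by_contra! hne
    have haB : Additive.ofMul (⟨a, a.2.1⟩ : π.ker) ∉ B := by
      rintro ⟨z, hz, hza⟩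
      exact hne ⟨z, hz⟩ hza
    have haB' : (QuotientAddGroup.mk (Additive.ofMul (⟨a, a.2.1⟩ : π.ker)) :
        Additive π.ker ⧸ B) ≠ 0 := fun h => haB ((QuotientAddGroup.eq_zero_iff _).1 h)
    obtain ⟨c, hca⟩ := CharacterModule.exists_character_apply_ne_zero_of_ne_zero haB'
    let χ : Additive π.ker →+ AddCircle (1 : ℚ) := AddMonoidHom.comp c (QuotientAddGroup.mk' B)
    have hχB : ∀ b ∈ B, χ b = 0 := by
      intro b hb
      change c (QuotientAddGroup.mk b) = 0
      rw [(QuotientAddGroup.eq_zero_iff b).2 hb]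
      exact map_zero c
    obtain ⟨ψ, hψ⟩ := exists_addMonoidHom_comp_eq d₂ (χ.comp L) (by
      intro z hz
      exact hχB _ ⟨z, hz, rfl⟩)
    let ψ' : G → AddCircle (1 : ℚ) := fun g => ψ (Finsupp.single g (ULift.up 1))
    have hψ' : ∀ g h, χ (Additive.ofMul (F (g, h))) = ψ' h - ψ' (g * h) + ψ' g := by
      intro g h
      have := hψ (Finsupp.single (g, h) (ULift.up 1))
      rw [hd₂, AddMonoidHom.comp_apply, hL, one_smul, map_add, map_sub] at this
      exact this.symm
    let κ : E → π.ker := fun x => ⟨x * (s (π x))⁻¹, by simp [MonoidHom.mem_ker, hs]⟩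
    have hκ : ∀ x, x = κ x * s (π x) := fun x => by simp [κ]
    have hκmul : ∀ x y, κ (x * y) = κ x * κ y * F (π x, π y) := by
      intro x y
      apply Subtype.ext
      apply mul_right_cancel (b := s (π (x * y)))
      rw [← hκ, map_mul]
      have hcen := Subgroup.mem_center_iff.1 (hc (κ y).2) (s (π x))
      calc x * y = (κ x * s (π x)) * (κ y * s (π y)) := by rw [← hκ, ← hκ]
        _ = κ x * (s (π x) * κ y) * s (π y) := by group
        _ = κ x * κ y * (s (π x) * s (π y)) := by rw [hcen]; group
        _ = _ := by rw [hF]; simp [mul_assoc]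
    -- `χ ∘ F` is the coboundary of `ψ'`, so `χ` extends to a homomorphism on `E`.
    let Ψ : E →* Multiplicative (AddCircle (1 : ℚ)) := MonoidHom.mk'
      (fun x => Multiplicative.ofAdd (χ (Additive.ofMul (κ x)) + ψ' (π x))) (by
        intro x y
        rw [← ofAdd_add]
        congr 1
        rw [hκmul, ofMul_mul, ofMul_mul, map_add, map_add, hψ', map_mul]
        abel)
    have h0 : χ (Additive.ofMul (κ a)) + ψ' (π a) = 0 :=
      Abelianization.commutator_subset_ker Ψ a.2.2
    have hπa : π a = 1 := a.2.1
    have hκa : κ a = ⟨a, a.2.1⟩ := Subtype.ext (by simp [κ, hπa, hs1])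
    have hψ1 : ψ' 1 = 0 := by
      have h1 := hψ' 1 1
      have h2 : F (1, 1) = 1 := Subtype.ext (by simp [F, hs1])
      rw [h2] at h1
      simpa using h1.symm
    rw [hπa, hψ1, add_zero, hκa] at h0
    exact hca h0
  choose z hz using hmem
  have := finite_schurMultiplier G
  refine Nat.card_le_card_of_injective
    (fun a => (groupHomology.H2π (trivialZ G) (z a) : schurMultiplier G)) fun a b hab => ?_
  obtain ⟨y, hy⟩ := (groupHomology.H2π_eq_iff (A := trivialZ G) (z a) (z b)).1 hab
  have h1 : L ((z a).1 - (z b).1) = 0 := by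
    rw [← hy]
    exact DFunLike.congr_fun hLd y
  rw [map_sub, hz, hz, sub_eq_zero] at h1
  have h2 : (⟨a, a.2.1⟩ : π.ker) = ⟨b, b.2.1⟩ := Additive.ofMul.injective h1
  exact Subtype.ext (congrArg (fun k : π.ker => (k : E)) h2)

end Schur

/-- For every finite group `G`: the groups whose orders are compared are finite,
`b₀(G) ≤ a_{(G,O)} ≤ h₂(G)` for every equipment `O` of `G`, and `G ∖ {1}` is an equipment of `G`
with `a_{(G, G ∖ {1})} = b₀(G)`. -/
theorem theorem1 (G : Type u) [Group G] [Finite G] :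
    Finite (bogomolovMultiplier G) ∧ Finite (schurMultiplier G) ∧
    (∀ O : Set G, IsEquipment O →
      Finite (ambiguityGroup O) ∧
      bogomolovOrder G ≤ ambiguityIndex O ∧ ambiguityIndex O ≤ schurOrder G) ∧
    IsEquipment ({1}ᶜ : Set G) ∧
    ambiguityIndex ({1}ᶜ : Set G) = bogomolovOrder G := by
  have range_card : ∀ (O : Set G) (hO : IsEquipment O),
      Finite (transgressionClass (CGroup.toBase_surjective hO)).range ∧
        Nat.card (transgressionClass (CGroup.toBase_surjective hO)).range = ambiguityIndex O := by
    intro O hO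
    have : Finite ↥((CGroup.toBase O).ker ⊓ commutator (CGroup O)) := finite_ambiguityGroup hO
    exact card_transgressionClass_range _ (CGroup.ker_toBase_le_center hO)
  obtain ⟨hfin, hcard⟩ := range_card _ (isEquipment_compl_one (G := G))
  rw [range_transgressionClass_compl_one] at hfin hcard
  refine ⟨hfin, finite_schurMultiplier G, fun O hO => ⟨finite_ambiguityGroup hO, ?_, ?_⟩,
    isEquipment_compl_one, hcard.symm⟩
  · obtain ⟨h1, h2⟩ := range_card O hO
    rw [← h2]
    exact AddSubgroup.card_le_of_le (H := (bogomolovMultiplier G).toAddSubgroup)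
      fun α hα => bogomolovMultiplier_subset_range hO hα
  · exact card_ker_inf_commutator_le (CGroup.toBase_surjective hO)
      (CGroup.ker_toBase_le_center hO)
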